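/- A finite simple graph $G=(V,E)$ is called \emph{3-balanced} if there is a coloring $\ell:V\to\mathbb{Z}/3\mathbb{Z}$ such that, for every vertex $v\in V$, the open neighborhood of $v$ contains equally many vertices of each of the three colors. For integers $m,j,k$ with $m\ge 4$, $1\le j<\frac m2$ and $1\le k\le \frac m2$, the \emph{generalized Pappus graph} $P(m,j,k)$ is the simple graph with vertex set $\{v_i,u_i,w_i \mid i\in\mathbb{Z}/m\mathbb{Z}\}$ and edges $v_iv_{i+1}$, $v_iu_i$, $u_iw_{i+j}$, $u_iw_{i-j}$ and $w_iw_{i+k}$ for $i\in\mathbb{Z}/m\mathbb{Z}$. \textbf{Theorem.} Let $m,j,k$ be integers with $m\ge 4$, $1\le j<\frac m2$ and $1\le k\le\frac m2$. Then $P(m,j,k)$ is 3-balanced if and only if $6\mid m$, $3\nmid j$ and $k=\frac m2$. -/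

import Mathlib

/-- A coloring `ℓ` of the vertices by `ℤ/3` is neighborhood 3-balanced if every open neighborhood
contains equally many vertices of each color. -/
def SimpleGraph.IsThreeBalancedColoring {V : Type*} (G : SimpleGraph V) (ℓ : V → ZMod 3) : Prop :=
  ∀ (x : V) (a b : ZMod 3),
    (G.neighborSet x ∩ ℓ ⁻¹' {a}).encard = (G.neighborSet x ∩ ℓ ⁻¹' {b}).encard

/-- A graph is 3-balanced if it admits a neighborhood 3-balanced coloring. -/
def SimpleGraph.IsThreeBalanced {V : Type*} (G : SimpleGraph V) : Prop :=
  ∃ ℓ : V → ZMod 3, G.IsThreeBalancedColoring ℓ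

/-- The vertices `v i`, `u i`, `w i` (exterior, middle, interior), with `i ∈ ℤ/m`. -/
inductive PappusVertex (m : ℕ) : Type
  | v (i : ZMod m) : PappusVertex m
  | u (i : ZMod m) : PappusVertex m
  | w (i : ZMod m) : PappusVertex m

/-- The oriented list of edges `v i — v (i+1)`, `v i — u i`, `u i — w (i+j)`, `u i — w (i-j)`,
`w i — w (i+k)`. -/
def pappusRel (m j k : ℕ) : PappusVertex m → PappusVertex m → Prop
  | .v a, .v b => b = a + 1
  | .v a, .u b => b = a
  | .u a, .w b => b = a + (j : ZMod m) ∨ b = a - (j : ZMod m)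
  | .w a, .w b => b = a + (k : ZMod m)
  | _, _ => False

/-- The generalized Pappus graph `P(m, j, k)`: the undirected simple graph with the edges listed in
`pappusRel` (meant for `4 ≤ m`, `1 ≤ j < m / 2`, `1 ≤ k ≤ m / 2`, when none of them is a loop). -/
def generalizedPappusGraph (m j k : ℕ) : SimpleGraph (PappusVertex m) :=
  SimpleGraph.fromRel (pappusRel m j k)

/-! If `3 ∤ j`, `6 ∣ m` and `2 * k = m`, colouring each vertex by its index mod 3 works. Conversely,
degrees must be divisible by 3, which forces `2 * k = m`. A zero-sum weight on colours then turns
balance into linear equations; eliminating `v` and `u` leaves a shift recurrence on the `w` values.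
A nonzero solution yields an `m`-th root of unity `x` with (x² + 1)(x^(2j) + 1)² = ±x^(2j+1). Galois
conjugation and integrality force x² to be a primitive cube root of unity (`pappus_relation_root`),
whence `3 ∣ m` and `3 ∤ j`. -/

/-! ### Roots of unity solving the frequency equation -/

open Polynomial in
/-- An integer polynomial vanishing at a root of unity vanishes at its powers with exponent coprime
to the order. -/
theorem aeval_pow_eq_zero_of_coprime_orderOf {x : ℂ} {m t : ℕ} (hm : 0 < m) (hx : x ^ m = 1)
    (ht : t.Coprime (orderOf x)) {Q : ℤ[X]} (hQ : aeval x Q = 0) : aeval (x ^ t) Q = 0 := by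
  have hprim := IsPrimitiveRoot.orderOf x
  have hpos : 0 < orderOf x := orderOf_pos_iff.2 (isOfFinOrder_iff_pow_eq_one.2 ⟨m, hm, hx⟩)
  have hint : IsIntegral ℤ x := hprim.isIntegral hpos
  have hmin := hprim.minpoly_eq_pow_coprime ht
  obtain ⟨R, rfl⟩ := minpoly.isIntegrallyClosed_dvd hint hQ
  rw [map_mul, hmin, minpoly.aeval, zero_mul]

theorem not_isIntegral_of_two_mul_eq_one {x : ℂ} (hx : 2 * x = 1) : ¬ IsIntegral ℤ x := by
  intro h
  have hx' : x = algebraMap ℚ ℂ (1 / 2) := by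
    rw [eq_ratCast]; push_cast; linear_combination hx / 2
  rw [hx', isIntegral_algebraMap_iff (algebraMap ℚ ℂ).injective] at h
  obtain ⟨y, hy⟩ := IsIntegrallyClosed.isIntegral_iff.1 h
  rw [eq_intCast] at hy
  have h2 : (2 * y : ℚ) = 1 := by rw [hy]; norm_num
  have h3 : 2 * y = 1 := by exact_mod_cast h2
  omega

/-- The frequency equation of the generalized Pappus graph is stable under Galois conjugation. -/
theorem pappus_relation_pow {x : ℂ} {m t j : ℕ} {e : ℤ} (hm : 0 < m) (hx : x ^ m = 1)
    (ht : t.Coprime (orderOf x))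
    (h : (x ^ 2 + 1) * (x ^ (2 * j) + 1) ^ 2 = e * x ^ (2 * j + 1)) :
    ((x ^ t) ^ 2 + 1) * ((x ^ t) ^ (2 * j) + 1) ^ 2 = e * (x ^ t) ^ (2 * j + 1) := by
  have key := aeval_pow_eq_zero_of_coprime_orderOf hm hx ht
    (Q := (Polynomial.X ^ 2 + 1) * (Polynomial.X ^ (2 * j) + 1) ^ 2 -
      Polynomial.C e * Polynomial.X ^ (2 * j + 1)) (by simp [h])
  simpa [sub_eq_zero] using key

/-- Odd order makes x ↦ x² a Galois conjugation. With A = x + x⁻¹ and C = (x^j + x^(-j))², the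
equation and its conjugate read AC = e and (A² - 2)(C - 2)² = e. Eliminating C leaves a quartic in
A, where integrality excludes everything but A = -1. -/
theorem pappus_relation_of_odd {x : ℂ} {d j : ℕ} {e : ℤ} (he : e = 1 ∨ e = -1) (hd : Odd d)
    (hx : x ^ d = 1) (h : (x ^ 2 + 1) * (x ^ (2 * j) + 1) ^ 2 = e * x ^ (2 * j + 1)) :
    x ^ 2 + x + 1 = 0 := by
  have hd0 : 0 < d := hd.pos
  have hx0 : x ≠ 0 := by rintro rfl; simp [hd0.ne'] at hx
  have hodd : Odd (orderOf x) := hd.of_dvd_nat (orderOf_dvd_of_pow_eq_one hx)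
  have h' := pappus_relation_pow hd0 hx (Nat.coprime_two_left.2 hodd) h
  have hiso : ∀ {z : ℂ}, z ^ d = 1 → IsIntegral ℤ z := fun hz =>
    IsIntegral.of_pow hd0 (by rw [hz]; exact isIntegral_one)
  have hinv : IsIntegral ℤ x⁻¹ := hiso (by rw [inv_pow, hx, inv_one])
  have hA : IsIntegral ℤ (x + x⁻¹) := (hiso hx).add hinv
  obtain ⟨A, hAdef⟩ : ∃ A, A = x + x⁻¹ := ⟨_, rfl⟩
  rw [← hAdef] at hA
  have hAx : A * x = x ^ 2 + 1 := by rw [hAdef]; field_simp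
  obtain ⟨y, hy⟩ : ∃ y, y = x ^ j := ⟨_, rfl⟩
  have hy0 : y ≠ 0 := by rw [hy]; exact pow_ne_zero _ hx0
  obtain ⟨C, hC⟩ : ∃ C, C = (y + y⁻¹) ^ 2 := ⟨_, rfl⟩
  have hCy : C * y ^ 2 = (y ^ 2 + 1) ^ 2 := by rw [hC]; field_simp
  have e1 : x ^ (2 * j) = y ^ 2 := by rw [hy]; ring
  have e2 : (x ^ 2) ^ (2 * j) = y ^ 4 := by rw [hy]; ring
  rw [pow_succ x (2 * j), e1] at h
  rw [pow_succ (x ^ 2) (2 * j), e2] at h'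
  have hAC : A * C = e := by
    have : (A * C - e) * (x * y ^ 2) = 0 := by
      linear_combination h + C * y ^ 2 * hAx + (x ^ 2 + 1) * hCy
    have := (mul_eq_zero.1 this).resolve_right (mul_ne_zero hx0 (pow_ne_zero _ hy0))
    linear_combination this
  have hAx' : (A ^ 2 - 2) * x ^ 2 = x ^ 4 + 1 := by
    linear_combination (A * x + x ^ 2 + 1) * hAx
  have hCy' : (C - 2) * y ^ 2 = y ^ 4 + 1 := by linear_combination hCy
  have hAC' : (A ^ 2 - 2) * (C - 2) ^ 2 = e := by
    have : ((A ^ 2 - 2) * (C - 2) ^ 2 - e) * (x ^ 2 * y ^ 4) = 0 := by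
      linear_combination h' + (C - 2) ^ 2 * y ^ 4 * hAx' +
        (x ^ 4 + 1) * ((C - 2) * y ^ 2 + y ^ 4 + 1) * hCy'
    have := (mul_eq_zero.1 this).resolve_right
      (mul_ne_zero (pow_ne_zero _ hx0) (pow_ne_zero _ hy0))
    linear_combination this
  have hE : (A ^ 2 - 2) * (e - 2 * A) ^ 2 = e * A ^ 2 := by
    linear_combination A ^ 2 * hAC' + (-(A ^ 2 - 2) * (A * C + e - 4 * A)) * hAC
  rcases he with rfl | rfl
  · exfalso
    push_cast at hE
    refine not_isIntegral_of_two_mul_eq_one (x := A ^ 4 - A ^ 3 - 2 * A ^ 2 + 2 * A) ?_ ?_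
    · linear_combination hE / 2
    · have h2 : IsIntegral ℤ (2 : ℂ) := isIntegral_algebraMap (x := (2 : ℤ))
      exact (((hA.pow 4).sub (hA.pow 3)).sub (h2.mul (hA.pow 2))).add (h2.mul hA)
  · push_cast at hE
    have hfac : (A + 1) ^ 2 * (2 * (A ^ 2 - A) - 1) = 0 := by linear_combination hE / 2
    rcases mul_eq_zero.1 hfac with h0 | h0
    · have h1 : A + 1 = 0 := by simpa using h0
      linear_combination x * h1 - hAx
    · exact absurd ((hA.pow 2).sub hA)
        (not_isIntegral_of_two_mul_eq_one (by linear_combination h0))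

theorem pappus_relation_root {x : ℂ} {m j : ℕ} {e : ℤ} (he : e = 1 ∨ e = -1) (hm : 0 < m)
    (hx : x ^ m = 1) (h : (x ^ 2 + 1) * (x ^ (2 * j) + 1) ^ 2 = e * x ^ (2 * j + 1)) :
    (x ^ 2) ^ 2 + x ^ 2 + 1 = 0 := by
  have hx0 : x ≠ 0 := by rintro rfl; simp [hm.ne'] at hx
  have hpos : 0 < orderOf x := orderOf_pos_iff.2 (isOfFinOrder_iff_pow_eq_one.2 ⟨m, hm, hx⟩)
  rcases Nat.even_or_odd (orderOf x) with hev | hodd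
  · obtain ⟨r, hr⟩ := hev
    have hrx : x ^ r = -1 := by
      have h1 : x ^ r * x ^ r = 1 := by rw [← pow_add, ← hr, pow_orderOf_eq_one]
      refine (mul_self_eq_one_iff.1 h1).resolve_left fun h2 => ?_
      have := Nat.le_of_dvd (by omega) (orderOf_dvd_of_pow_eq_one h2)
      omega
    rcases Nat.even_or_odd r with hre | hro
    -- Conjugation sends x to -x, which fixes the left side of the equation and negates the right.
    · exfalso
      have hcop : (1 + r).Coprime (orderOf x) := by
        have h1 : (1 + r).Coprime r := by simp
        have h2 : (1 + r).Coprime 2 :=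
          Nat.coprime_two_right.2 (by rw [add_comm]; exact hre.add_one)
        rw [hr, ← two_mul]
        exact h2.mul_right h1
      have h' := pappus_relation_pow hm hx hcop h
      have hneg : x ^ (1 + r) = -x := by rw [pow_add, hrx]; ring
      rw [hneg, (even_two_mul j).neg_pow, (odd_two_mul_add_one j).neg_pow, neg_sq, h] at h'
      have h3 : (e : ℂ) * x ^ (2 * j + 1) = 0 := by linear_combination h' / 2
      rcases he with rfl | rfl <;> simp [hx0] at h3
    -- Here -x has odd order and satisfies the equation with sign -e.
    · have := pappus_relation_of_odd (x := -x) (e := -e) (j := j) (by omega) hro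
        (by rw [hro.neg_pow, hrx, neg_neg]) (by
          rw [(even_two_mul j).neg_pow, (odd_two_mul_add_one j).neg_pow, neg_sq, h]
          push_cast; ring)
      linear_combination (x ^ 2 + x + 1) * this
  · have := pappus_relation_of_odd he hodd (pow_orderOf_eq_one x) h
    linear_combination (x ^ 2 - x + 1) * this

theorem pappus_relation_three_dvd {x : ℂ} {m j : ℕ} {e : ℤ} (he : e = 1 ∨ e = -1) (hm : 0 < m)
    (hx : x ^ m = 1) (h : (x ^ 2 + 1) * (x ^ (2 * j) + 1) ^ 2 = e * x ^ (2 * j + 1)) :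
    3 ∣ m ∧ ¬ 3 ∣ j := by
  have hx0 : x ≠ 0 := by rintro rfl; simp [hm.ne'] at hx
  have hroot := pappus_relation_root he hm hx h
  have hcube : (x ^ 2) ^ 3 = 1 := by linear_combination (x ^ 2 - 1) * hroot
  constructor
  · have hne : x ^ 2 ≠ 1 := by
      intro h1; rw [h1] at hroot; norm_num at hroot
    rw [← orderOf_eq_prime hcube hne]
    exact orderOf_dvd_of_pow_eq_one (by rw [← pow_mul, mul_comm, pow_mul, hx, one_pow])
  · rintro ⟨q, rfl⟩
    have h1 : x ^ (2 * (3 * q)) = 1 := by rw [pow_mul, pow_mul, hcube, one_pow]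
    have he2 : (e : ℂ) ^ 2 = 1 := by rcases he with rfl | rfl <;> norm_num
    rw [pow_succ x (2 * (3 * q)), h1] at h
    -- The equation is now 4(x² + 1) = ex; squaring, with (x² + 1)² = x², gives 16x² = x².
    have h2 : x ^ 2 * 15 = 0 := by
      linear_combination (4 * (x ^ 2 + 1) + e * x) * h + x ^ 2 * he2 - 16 * hroot
    simp [hx0] at h2

/-! ### Shift operators on ℤ/m -/

theorem shift_pow_apply {m : ℕ} (H : ZMod m → ℂ) (n : ℕ) (i : ZMod m) :
    (LinearMap.funLeft ℂ ℂ (fun i : ZMod m => i + 1) ^ n) H i = H (i + n) := by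
  induction n generalizing i with
  | zero => simp
  | succ n ih =>
    rw [pow_succ', Module.End.mul_apply, LinearMap.funLeft_apply, ih]
    push_cast; ring_nf

open Polynomial in
/-- A nonzero function on `ℤ/m` annihilated by a polynomial in the shift yields an `m`-th root of
unity that is a root of this polynomial. -/
theorem exists_root_of_shift_annihilated {m : ℕ} (H : ZMod m → ℂ) (hH : H ≠ 0) (p : ℂ[X])
    (hp : aeval (LinearMap.funLeft ℂ ℂ (fun i : ZMod m => i + 1)) p H = 0) :
    ∃ x : ℂ, x ^ m = 1 ∧ p.eval x = 0 := by
  by_contra! hcon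
  set S := LinearMap.funLeft ℂ ℂ (fun i : ZMod m => i + 1) with hS
  -- Without a common root, Bézout writes 1 as a combination of two polynomials that both annihilate
  -- `H`.
  have hcop : IsCoprime (X ^ m - 1 : ℂ[X]) p := by
    rw [isCoprime_iff_aeval_ne_zero_of_isAlgClosed ℂ ℂ]
    intro x
    by_cases hx : x ^ m = 1
    · right; simpa using hcon x hx
    · left; simpa [sub_eq_zero] using hx
  obtain ⟨a, b, hab⟩ := hcop
  have h1 : aeval S (X ^ m - 1 : ℂ[X]) H = 0 := by
    ext i; simp [hS, shift_pow_apply]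
  have h2 := congrArg (fun q => aeval S q H) hab
  simp only [map_add, map_mul, LinearMap.add_apply, Module.End.mul_apply, h1, hp, map_zero,
    add_zero, map_one, Module.End.one_apply] at h2
  exact hH h2.symm

/-! ### Consequences of balance at a vertex -/

namespace SimpleGraph

variable {V : Type*} {G : SimpleGraph V} {ℓ : V → ZMod 3}

theorem IsThreeBalancedColoring.exists_card_filter [DecidableEq V]
    (h : G.IsThreeBalancedColoring ℓ) {x : V} {s : Finset V} (hs : G.neighborSet x = s) :
    ∃ n : ℕ, ∀ a, (s.filter (ℓ · = a)).card = n := by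
  refine ⟨(s.filter (ℓ · = 0)).card, fun a => ?_⟩
  have hab := h x a 0
  have hset : ∀ c, G.neighborSet x ∩ ℓ ⁻¹' {c} = ((s.filter (ℓ · = c) : Finset V) : Set V) := by
    intro c; ext y; simp [hs]
  rw [hset, hset, Set.encard_coe_eq_coe_finsetCard, Set.encard_coe_eq_coe_finsetCard] at hab
  exact_mod_cast hab

theorem IsThreeBalancedColoring.three_dvd_card [DecidableEq V]
    (h : G.IsThreeBalancedColoring ℓ) {x : V} {s : Finset V} (hs : G.neighborSet x = s) :
    3 ∣ s.card := by
  obtain ⟨n, hn⟩ := h.exists_card_filter hs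
  rw [Finset.card_eq_sum_card_fiberwise (f := ℓ) (t := Finset.univ) (by simp)]
  simp [hn, ZMod.card]

theorem IsThreeBalancedColoring.sum_eq_zero [DecidableEq V]
    (h : G.IsThreeBalancedColoring ℓ) {x : V} {s : Finset V} (hs : G.neighborSet x = s)
    {g : ZMod 3 → ℂ} (hg : ∑ c, g c = 0) : ∑ y ∈ s, g (ℓ y) = 0 := by
  obtain ⟨n, hn⟩ := h.exists_card_filter hs
  rw [← Finset.sum_fiberwise_of_maps_to (g := ℓ) (t := Finset.univ) (by simp)]
  have : ∀ c, ∑ y ∈ s with ℓ y = c, g (ℓ y) = n * g c := by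
    intro c
    rw [Finset.sum_congr rfl (g := fun _ => g c) (by simp +contextual)]
    simp [hn]
  simp_rw [this]
  rw [← Finset.mul_sum, hg, mul_zero]

theorem encard_neighborSet_inter_eq_one {x p q r : V} (hs : G.neighborSet x = {p, q, r})
    (hpq : ℓ p ≠ ℓ q) (hpr : ℓ p ≠ ℓ r) (hqr : ℓ q ≠ ℓ r) (c : ZMod 3) :
    (G.neighborSet x ∩ ℓ ⁻¹' {c}).encard = 1 := by
  have hc : ∀ a b d c : ZMod 3, a ≠ b → a ≠ d → b ≠ d → c = a ∨ c = b ∨ c = d := by decide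
  rw [Set.encard_eq_one, hs]
  rcases hc _ _ _ c hpq hpr hqr with rfl | rfl | rfl
  · refine ⟨p, ?_⟩
    ext y
    simp only [Set.mem_inter_iff, Set.mem_insert_iff, Set.mem_singleton_iff, Set.mem_preimage]
    grind
  · refine ⟨q, ?_⟩
    ext y
    simp only [Set.mem_inter_iff, Set.mem_insert_iff, Set.mem_singleton_iff, Set.mem_preimage]
    grind
  · refine ⟨r, ?_⟩
    ext y
    simp only [Set.mem_inter_iff, Set.mem_insert_iff, Set.mem_singleton_iff, Set.mem_preimage]
    grind

end SimpleGraph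

/-! ### Application to the Pappus graph -/

namespace PappusVertex

variable {m j k : ℕ}

theorem natCast_ne_zero_of_lt {n : ℕ} (h0 : 0 < n) (h : n < m) : (n : ZMod m) ≠ 0 := by
  rw [Ne, ZMod.natCast_eq_zero_iff]
  exact Nat.not_dvd_of_pos_of_lt h0 h

theorem neighborSet_v (hm : 4 ≤ m) (i : ZMod m) :
    (generalizedPappusGraph m j k).neighborSet (.v i) = {.v (i + 1), .v (i - 1), .u i} := by
  have h1 : (1 : ZMod m) ≠ 0 := by
    simpa using natCast_ne_zero_of_lt (m := m) (n := 1) (by omega) (by omega)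
  ext y
  cases y <;>
    simp only [generalizedPappusGraph, SimpleGraph.mem_neighborSet, SimpleGraph.fromRel_adj,
      pappusRel, Set.mem_insert_iff, Set.mem_singleton_iff, reduceCtorEq, v.injEq, u.injEq] <;>
    grind

theorem neighborSet_u (i : ZMod m) :
    (generalizedPappusGraph m j k).neighborSet (.u i) = {.v i, .w (i + j), .w (i - j)} := by
  ext y
  cases y <;>
    simp only [generalizedPappusGraph, SimpleGraph.mem_neighborSet, SimpleGraph.fromRel_adj,
      pappusRel, Set.mem_insert_iff, Set.mem_singleton_iff, reduceCtorEq, v.injEq, w.injEq] <;>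
    grind

theorem neighborSet_w (hk : (k : ZMod m) ≠ 0) (i : ZMod m) :
    (generalizedPappusGraph m j k).neighborSet (.w i) =
      {.u (i - j), .u (i + j), .w (i + k), .w (i - k)} := by
  ext y
  cases y <;>
    simp only [generalizedPappusGraph, SimpleGraph.mem_neighborSet, SimpleGraph.fromRel_adj,
      pappusRel, Set.mem_insert_iff, Set.mem_singleton_iff, reduceCtorEq, u.injEq, w.injEq] <;>
    grind

theorem isThreeBalanced_of_dvd (hm : 4 ≤ m) (h6 : 6 ∣ m) (h3 : ¬ 3 ∣ j) (hk : 2 * k = m) :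
    (generalizedPappusGraph m j k).IsThreeBalanced := by
  have h3m : 3 ∣ m := by omega
  let φ := ZMod.castHom h3m (ZMod 3)
  -- Since 6 ∣ 2k, the neighbour `w (i + k)` has the colour of `w i`.
  have hk3 : (k : ZMod 3) = 0 := by rw [ZMod.natCast_eq_zero_iff]; omega
  have hj3 : (j : ZMod 3) ≠ 0 := by rwa [Ne, ZMod.natCast_eq_zero_iff]
  have hkm : (k : ZMod m) ≠ 0 := natCast_ne_zero_of_lt (by omega) (by omega)
  have h2k : (k : ZMod m) + k = 0 := by
    rw [← Nat.cast_add, ← two_mul, hk, ZMod.natCast_self]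
  let ℓ : PappusVertex m → ZMod 3
    | .v i => φ i
    | .u i => φ i
    | .w i => φ i
  have hd : ∀ a d : ZMod 3, d ≠ 0 → a + d ≠ a - d ∧ a + d ≠ a ∧ a - d ≠ a := by decide
  refine ⟨ℓ, fun x a b => ?_⟩
  suffices H : ∀ c, ((generalizedPappusGraph m j k).neighborSet x ∩ ℓ ⁻¹' {c}).encard = 1 by
    rw [H, H]
  cases x with
  | v i =>
    have := hd (φ i) 1 (by decide)
    refine SimpleGraph.encard_neighborSet_inter_eq_one (neighborSet_v hm i) ?_ ?_ ?_ <;>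
      simp only [ℓ, map_add, map_sub, map_one] <;> tauto
  | u i =>
    have := hd (φ i) j hj3
    refine SimpleGraph.encard_neighborSet_inter_eq_one (neighborSet_u i) ?_ ?_ ?_ <;>
      simp only [ℓ, map_add, map_sub, map_natCast] <;> grind
  | w i =>
    have := hd (φ i) j hj3
    have hs := neighborSet_w (j := j) hkm i
    have hw : i - (k : ZMod m) = i + k := by linear_combination -h2k
    rw [hw, Set.pair_eq_singleton] at hs
    refine SimpleGraph.encard_neighborSet_inter_eq_one hs ?_ ?_ ?_ <;>
      simp only [ℓ, map_add, map_sub, map_natCast, hk3, add_zero] <;> grind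

/-- Otherwise `w 0` has four distinct neighbours. -/
theorem two_mul_eq_of_isThreeBalanced (hj : 1 ≤ j) (hjm : 2 * j < m)
    (hk : 1 ≤ k) (hkm : 2 * k ≤ m) (h : (generalizedPappusGraph m j k).IsThreeBalanced) :
    2 * k = m := by
  classical
  by_contra hne
  obtain ⟨ℓ, hℓ⟩ := h
  have hk0 : (k : ZMod m) ≠ 0 := natCast_ne_zero_of_lt (by omega) (by omega)
  have h2k := natCast_ne_zero_of_lt (m := m) (n := 2 * k) (by omega) (by omega)
  have h2j := natCast_ne_zero_of_lt (m := m) (n := 2 * j) (by omega) (by omega)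
  push_cast at h2k h2j
  have hdvd := hℓ.three_dvd_card (x := .w 0)
    (s := {.u (0 - j), .u (0 + j), .w (0 + k), .w (0 - k)}) (by
      rw [neighborSet_w hk0]; simp)
  have h1 : -(j : ZMod m) ≠ j := by grind
  have h2 : (k : ZMod m) ≠ -k := by grind
  simp [h1, h2] at hdvd

theorem dvd_of_isThreeBalanced (hm : 4 ≤ m) (hj : 1 ≤ j) (hjm : 2 * j < m)
    (hk : 2 * k = m) (h : (generalizedPappusGraph m j k).IsThreeBalanced) :
    3 ∣ m ∧ ¬ 3 ∣ j := by
  classical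
  obtain ⟨ℓ, hℓ⟩ := h
  have h2 := natCast_ne_zero_of_lt (m := m) (n := 2) (by omega) (by omega)
  have h2j := natCast_ne_zero_of_lt (m := m) (n := 2 * j) (by omega) (by omega)
  have hk0 : (k : ZMod m) ≠ 0 := natCast_ne_zero_of_lt (by omega) (by omega)
  have h2k : (k : ZMod m) + k = 0 := by
    rw [← Nat.cast_add, ← two_mul, hk, ZMod.natCast_self]
  push_cast at h2 h2j
  -- Zero sum gives the linear equations; having no zero value ensures `H ≠ 0` below.
  let g : ZMod 3 → ℂ := fun c => if c = 2 then -2 else 1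
  have hg : ∑ c, g c = 0 := by
    have : ∑ c, g c = g 0 + g 1 + g 2 := Fin.sum_univ_three g
    rw [this]
    have h02 : (0 : ZMod 3) ≠ 2 := by decide
    have h12 : (1 : ZMod 3) ≠ 2 := by decide
    simp only [g, if_neg h02, if_neg h12, if_true]; norm_num
  have hg0 : ∀ c, g c ≠ 0 := by intro c; simp only [g]; split_ifs <;> norm_num
  have hV : ∀ i, g (ℓ (.v (i + 1))) + g (ℓ (.v (i - 1))) + g (ℓ (.u i)) = 0 := by
    intro i
    have := hℓ.sum_eq_zero (x := .v i) (s := {.v (i + 1), .v (i - 1), .u i})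
      (by rw [neighborSet_v hm]; simp) hg
    have h1 : i + 1 ≠ i - 1 := by grind
    rw [Finset.sum_insert (by simp [h1]), Finset.sum_insert (by simp),
      Finset.sum_singleton] at this
    linear_combination this
  have hU : ∀ i, g (ℓ (.v i)) + g (ℓ (.w (i + j))) + g (ℓ (.w (i - j))) = 0 := by
    intro i
    have := hℓ.sum_eq_zero (x := .u i) (s := {.v i, .w (i + j), .w (i - j)})
      (by rw [neighborSet_u]; simp) hg
    have h1 : i + (j : ZMod m) ≠ i - j := by grind
    rw [Finset.sum_insert (by simp), Finset.sum_insert (by simp [h1]),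
      Finset.sum_singleton] at this
    linear_combination this
  have hW : ∀ i, g (ℓ (.u (i - j))) + g (ℓ (.u (i + j))) + g (ℓ (.w (i + k))) = 0 := by
    intro i
    have hw : i - (k : ZMod m) = i + k := by linear_combination -h2k
    have := hℓ.sum_eq_zero (x := .w i) (s := {.u (i - j), .u (i + j), .w (i + k)})
      (by rw [neighborSet_w hk0, hw, Set.pair_eq_singleton]; simp) hg
    have h1 : i - (j : ZMod m) ≠ i + j := by grind
    rw [Finset.sum_insert (by simp [h1]), Finset.sum_insert (by simp),
      Finset.sum_singleton] at this
    linear_combination this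
  let H : ZMod m → ℂ := fun i => g (ℓ (.w i))
  have hH : H ≠ 0 := fun h0 => hg0 _ (congrFun h0 0)
  let p : Polynomial ℂ := .X ^ (k + (2 * j + 1)) + (.X ^ (4 * j + 2) + .X ^ (4 * j) +
    (.X ^ (2 * j + 2) + .X ^ (2 * j + 2)) + (.X ^ (2 * j) + .X ^ (2 * j)) + .X ^ 2 + .X ^ 0)
  have hrec : ∀ i : ZMod m, H (i + k + 2 * j + 1) + (H (i + 4 * j + 2) + H (i + 4 * j) +
      2 * H (i + 2 * j + 2) + 2 * H (i + 2 * j) + H (i + 2) + H i) = 0 := by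
    intro i
    have w0 := hW (i + 2 * j + 1)
    have v1 := hV (i + j + 1)
    have v2 := hV (i + 3 * j + 1)
    have u1 := hU (i + j)
    have u2 := hU (i + j + 2)
    have u3 := hU (i + 3 * j)
    have u4 := hU (i + 3 * j + 2)
    simp only [H]
    ring_nf at w0 v1 v2 u1 u2 u3 u4 ⊢
    linear_combination w0 - v1 - v2 + u1 + u2 + u3 + u4
  obtain ⟨x, hxm, hx⟩ := exists_root_of_shift_annihilated H hH p (by
    ext i
    simp only [p, map_add, map_pow, Polynomial.aeval_X, LinearMap.add_apply, Pi.add_apply,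
      shift_pow_apply, Pi.zero_apply]
    have := hrec i
    push_cast
    ring_nf at this ⊢
    exact this)
  have hxk : x ^ k * x ^ k = 1 := by rw [← pow_add, ← two_mul, hk, hxm]
  simp only [p, Polynomial.eval_add, Polynomial.eval_pow, Polynomial.eval_X] at hx
  have hm0 : 0 < m := by omega
  -- The sign in the frequency equation is e = -x^k.
  rcases mul_self_eq_one_iff.1 hxk with h1 | h1
  · refine pappus_relation_three_dvd (e := -1) (by simp) hm0 hxm ?_
    rw [pow_add, h1] at hx
    push_cast
    linear_combination hx
  · refine pappus_relation_three_dvd (e := 1) (by simp) hm0 hxm ?_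
    rw [pow_add, h1] at hx
    push_cast
    linear_combination hx

end PappusVertex

theorem mainTheorem2 (m j k : ℕ) (hm : 4 ≤ m) (hj : 1 ≤ j) (hjm : 2 * j < m)
    (hk : 1 ≤ k) (hkm : 2 * k ≤ m) :
    (generalizedPappusGraph m j k).IsThreeBalanced ↔ 6 ∣ m ∧ ¬ 3 ∣ j ∧ 2 * k = m := by
  constructor
  · intro h
    have h2k := PappusVertex.two_mul_eq_of_isThreeBalanced hj hjm hk hkm h
    obtain ⟨h3, h3j⟩ := PappusVertex.dvd_of_isThreeBalanced hm hj hjm h2k h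
    exact ⟨by omega, h3j, h2k⟩
  · rintro ⟨h6, h3, h2k⟩
    exact PappusVertex.isThreeBalanced_of_dvd hm h6 h3 h2k
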